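/- Let $k$ be a field, $R=k[x_1,\dots,x_n]$ with its standard grading, and for $J\subseteq\{1,\dots,n\}$ let $\mathfrak m_J=(x_j : j\in J)\subseteq R$. Let $J_1,\dots,J_s\subseteq\{1,\dots,n\}$ be pairwise disjoint nonempty subsets, let $a_1,\dots,a_s$ be positive integers, and put $a=a_1+\cdots+a_s$ and $$I=\mathfrak m_{J_1}^{a_1}\mathfrak m_{J_2}^{a_2}\cdots\mathfrak m_{J_s}^{a_s}.$$ For a homogeneous ideal, let $\beta_{i,j}(I)$ denote the number of summands $R(-j)$ in the $i$-th module $F_i$ of a minimal graded free resolution $\cdots\to F_1\to F_0\to I\to 0$ over $R$. Then $I=\mathfrak m_{J_1}^{a_1}\cap\cdots\cap\mathfrak m_{J_s}^{a_s}$; a minimal graded free resolution of $I$ (with all $F_i$ of finite rank) exists, and for every such resolution $$\beta_{i,i+a}(I)=\sum_{i_1+\cdots+i_s=i}\ \prod_{l=1}^{s}\binom{a_l+|J_l|-1}{a_l+i_l}\binom{a_l+i_l-1}{i_l}\qquad\text{for all } i\ge 0,$$ where the sum is over $s$-tuples of nonnegative integers, and $\beta_{i,j}(I)=0$ for all $i,j\ge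 0$ with $j\ne i+a$. In particular $I$, which is generated by forms of degree $a$, has a linear resolution. -/

import Mathlib

/-- The monomial prime ideal `𝔪_J = (x_j : j ∈ J)` of `k[x_1, …, x_n]`. -/
noncomputable def monomialPrime (k : Type*) [Field k] {n : ℕ} (J : Finset (Fin n)) :
    Ideal (MvPolynomial (Fin n) k) :=
  Ideal.span ((fun j : Fin n => (MvPolynomial.X j : MvPolynomial (Fin n) k)) '' (J : Set (Fin n)))

/-- The graded maximal ideal `(x_1, …, x_n)`. -/
noncomputable def gradedMaximalIdeal (k : Type*) [Field k] (n : ℕ) :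
    Ideal (MvPolynomial (Fin n) k) :=
  Ideal.span (Set.range fun j : Fin n => (MvPolynomial.X j : MvPolynomial (Fin n) k))

/-- The free module `ι →₀ R` is graded as `⨁_b R(-deg b)`: the basis vector with index `b` has
degree `deg b`.  The predicate says that `v` is homogeneous of degree `e` for this grading (as
usual, the zero vector is homogeneous of every degree). -/
def IsHomogeneousVector {k : Type*} [Field k] {n : ℕ} {ι : Type*} (deg : ι → ℕ) (e : ℕ)
    (v : ι →₀ MvPolynomial (Fin n) k) : Prop :=
  ∀ b : ι, ∀ m ∈ (v b).support, deg b + m.degree = e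

/-- A minimal graded free resolution `⋯ → F_1 → F_0 → I → 0` of an ideal `I` of
`R = k[x_1, …, x_n]`, where `F_i = ⨁_{b ∈ idx i} R(-deg i b)` has finite rank.  All maps are
graded of degree zero, the augmented complex is exact, and the image of every differential
lies in `(x_1, …, x_n) F_i`.  For an ideal of `R` no negative degrees occur in such a
resolution, so the degrees are taken in `ℕ`. -/
structure MinimalGradedFreeResolution {k : Type*} [Field k] {n : ℕ}
    (I : Ideal (MvPolynomial (Fin n) k)) where
  /-- index set of the homogeneous basis of `F_i` -/
  idx : ℕ → Type
  finite_idx : ∀ i, Finite (idx i)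
  /-- degrees of the basis elements -/
  deg : ∀ i, idx i → ℕ
  /-- the differential `F_{i+1} → F_i` -/
  d : ∀ i, (idx (i + 1) →₀ MvPolynomial (Fin n) k) →ₗ[MvPolynomial (Fin n) k]
    (idx i →₀ MvPolynomial (Fin n) k)
  /-- the augmentation `F_0 → I` -/
  aug : (idx 0 →₀ MvPolynomial (Fin n) k) →ₗ[MvPolynomial (Fin n) k] I
  d_graded : ∀ i (b : idx (i + 1)),
    IsHomogeneousVector (deg i) (deg (i + 1) b) (d i (Finsupp.single b 1))
  aug_graded : ∀ b : idx 0,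
    (aug (Finsupp.single b 1) : MvPolynomial (Fin n) k).IsHomogeneous (deg 0 b)
  aug_surjective : Function.Surjective aug
  exact_zero : Function.Exact (d 0) aug
  exact_succ : ∀ i, Function.Exact (d (i + 1)) (d i)
  minimal : ∀ i, LinearMap.range (d i) ≤
    gradedMaximalIdeal k n • (⊤ : Submodule (MvPolynomial (Fin n) k)
      (idx i →₀ MvPolynomial (Fin n) k))

/-- The graded Betti number `β_{i,j}` read off from a minimal graded free resolution: the number
of summands `R(-j)` in `F_i`. -/
noncomputable def MinimalGradedFreeResolution.betti {k : Type*} [Field k] {n : ℕ}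
    {I : Ideal (MvPolynomial (Fin n) k)} (F : MinimalGradedFreeResolution I) (i j : ℕ) : ℕ :=
  Nat.card {b : F.idx i // F.deg i b = j}

/-- `I` is generated by forms of degree `d` and has a linear resolution: a minimal graded free
resolution exists, and (in each one) `β_{i,j}(I) = 0` for all `i` and all `j ≠ i + d`. -/
def HasLinearResolution {k : Type*} [Field k] {n : ℕ}
    (I : Ideal (MvPolynomial (Fin n) k)) (d : ℕ) : Prop :=
  (∃ S : Set (MvPolynomial (Fin n) k), (∀ f ∈ S, f.IsHomogeneous d) ∧ Ideal.span S = I) ∧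
  Nonempty (MinimalGradedFreeResolution I) ∧
  ∀ F : MinimalGradedFreeResolution I, ∀ i j : ℕ, j ≠ i + d → F.betti i j = 0

/-! A minimal linear resolution is built by iterated mapping cones, one variable at a time. Let $Q$
be generated by polynomials free of the variables of $J=J'\cup\{x\}$, with $x\notin J'$, and put
$A=\mathfrak m_{J'}^{a+1}Q$, $B=\mathfrak m_J^aQ$. Then $\mathfrak m_J^{a+1}Q=A+xB$ and $A\subseteq
B$. Since $x$ is a nonzerodivisor modulo $A$, $A\cap xB=xA$, which gives $0\to A(-1)\to A\oplus
B(-1)\to A+xB\to 0$. If $A$ and $B$ have linear resolutions, all entries of the cone are linear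
forms, so the cone is again minimal and linear (`HasLinearBetti.cone`). The generating functions
satisfy $P_{r+1,a+1}=(1+X)P_{r,a+1}+P_{r+1,a}$, which is Pascal's rule (`bettiSeries_succ_succ`).
Carrying $Q$ along lets the factors be multiplied in one after another
(`HasLinearBetti.monomialPrime_pow_mul`), so no tensor product of resolutions is needed.

The numbers are the same for every minimal resolution: comparison maps in both directions compose to
the identity modulo $(x_1,\dots,x_n)$ (`betti_eq`). That the product equals the intersection follows
by dividing by one variable at a time (`monomialPrime_pow_inf`). -/

open MvPolynomial

/-! ### Graded free modules and lifting of graded maps -/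

section GradedVectors

variable {k : Type*} [Field k] {n : ℕ} {ι κ τ : Type*}

theorem IsHomogeneousVector.zero (deg : ι → ℕ) (e : ℕ) :
    IsHomogeneousVector deg e (0 : ι →₀ MvPolynomial (Fin n) k) := by
  intro b m hm
  simp at hm

theorem IsHomogeneousVector.add {deg : ι → ℕ} {e : ℕ} {v w : ι →₀ MvPolynomial (Fin n) k}
    (hv : IsHomogeneousVector deg e v) (hw : IsHomogeneousVector deg e w) :
    IsHomogeneousVector deg e (v + w) := by
  classical
  intro b m hm
  rcases Finset.mem_union.1 (support_add (by simpa using hm)) with h | h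
  · exact hv b m h
  · exact hw b m h

theorem IsHomogeneousVector.sum {α : Type*} {deg : ι → ℕ} {e : ℕ} (s : Finset α)
    {v : α → ι →₀ MvPolynomial (Fin n) k}
    (hv : ∀ i ∈ s, IsHomogeneousVector deg e (v i)) :
    IsHomogeneousVector deg e (∑ i ∈ s, v i) :=
  Finset.sum_induction _ (IsHomogeneousVector deg e) (fun _ _ => .add) (.zero _ _) hv

theorem degree_of_mem_support {p : MvPolynomial (Fin n) k} {c : ℕ} (hp : p.IsHomogeneous c)
    {m : Fin n →₀ ℕ} (hm : m ∈ p.support) : m.degree = c := by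
  have := hp (mem_support_iff.1 hm)
  rwa [Finsupp.degree_eq_weight_one]

theorem isHomogeneous_of_degree {p : MvPolynomial (Fin n) k} {c : ℕ}
    (h : ∀ m ∈ p.support, m.degree = c) : p.IsHomogeneous c := by
  intro m hm
  have := h m (mem_support_iff.2 hm)
  rwa [Finsupp.degree_eq_weight_one] at this

theorem IsHomogeneousVector.smul {deg : ι → ℕ} {e e' : ℕ} {v : ι →₀ MvPolynomial (Fin n) k}
    (hv : IsHomogeneousVector deg e v) {p : MvPolynomial (Fin n) k}
    (hp : ∀ m ∈ p.support, e + m.degree = e') : IsHomogeneousVector deg e' (p • v) := by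
  classical
  intro b m hm
  rw [Finsupp.smul_apply, smul_eq_mul] at hm
  obtain ⟨m₁, h₁, m₂, h₂, rfl⟩ := Finset.mem_add.1 (support_mul _ _ hm)
  have := hv b m₂ h₂
  have := hp m₁ h₁
  rw [map_add]
  omega

/-- A linear map of degree zero between graded free modules. -/
def IsGradedMap (degι : ι → ℕ) (degκ : κ → ℕ)
    (f : (ι →₀ MvPolynomial (Fin n) k) →ₗ[MvPolynomial (Fin n) k]
      (κ →₀ MvPolynomial (Fin n) k)) : Prop :=
  ∀ b, IsHomogeneousVector degκ (degι b) (f (Finsupp.single b 1))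


theorem IsGradedMap.apply {degι : ι → ℕ} {degκ : κ → ℕ}
    {f : (ι →₀ MvPolynomial (Fin n) k) →ₗ[MvPolynomial (Fin n) k]
      (κ →₀ MvPolynomial (Fin n) k)} (hf : IsGradedMap degι degκ f) {e : ℕ}
    {v : ι →₀ MvPolynomial (Fin n) k} (hv : IsHomogeneousVector degι e v) :
    IsHomogeneousVector degκ e (f v) := by
  have : f v = ∑ b ∈ v.support, v b • f (Finsupp.single b 1) := by
    conv_lhs => rw [← v.sum_single]
    rw [Finsupp.sum, map_sum]
    refine Finset.sum_congr rfl fun b _ => ?_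
    rw [← map_smul, Finsupp.smul_single_one]
  rw [this]
  exact .sum _ fun b _ => (hf b).smul (hv b)

/-- The homogeneous component of degree `e` of a vector of the graded free module `ι →₀ R`. -/
noncomputable def vectorComponent (deg : ι → ℕ) (e : ℕ) :
    (ι →₀ MvPolynomial (Fin n) k) →ₗ[k] (ι →₀ MvPolynomial (Fin n) k) :=
  Finsupp.lsum k fun b => Finsupp.lsingle b ∘ₗ
    -- Without the guard, truncated subtraction would keep constant terms in coordinates with `deg b
    -- > e`.
    (if deg b ≤ e then homogeneousComponent (e - deg b) else 0)

theorem coeff_vectorComponent (deg : ι → ℕ) (e : ℕ) (v : ι →₀ MvPolynomial (Fin n) k) (b : ι)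
    (m : Fin n →₀ ℕ) :
    coeff m (vectorComponent deg e v b) = if deg b + m.degree = e then coeff m (v b) else 0 := by
  classical
  induction v using Finsupp.induction_linear with
  | zero => simp
  | add v w hv hw =>
    rw [map_add, Finsupp.add_apply, coeff_add, hv, hw, Finsupp.add_apply, coeff_add]
    split_ifs <;> simp
  | single c p =>
    simp only [vectorComponent, Finsupp.lsum_single, LinearMap.comp_apply, Finsupp.lsingle_apply]
    by_cases hcb : c = b
    · subst hcb
      rw [Finsupp.single_eq_same, Finsupp.single_eq_same]
      by_cases h : deg c ≤ e
      · rw [if_pos h, coeff_homogeneousComponent]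
        congr 1
        exact propext (by omega)
      · rw [if_neg h, if_neg (by omega)]
        simp
    · simp [hcb]

theorem isHomogeneousVector_vectorComponent (deg : ι → ℕ) (e : ℕ)
    (v : ι →₀ MvPolynomial (Fin n) k) :
    IsHomogeneousVector deg e (vectorComponent deg e v) := by
  intro b m hm
  rw [mem_support_iff, coeff_vectorComponent] at hm
  by_contra h
  exact hm (if_neg h)

theorem IsHomogeneousVector.vectorComponent {deg : ι → ℕ} {e' : ℕ}
    {v : ι →₀ MvPolynomial (Fin n) k} (hv : IsHomogeneousVector deg e' v) (e : ℕ) :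
    vectorComponent deg e v = if e' = e then v else 0 := by
  ext b m
  rw [coeff_vectorComponent]
  by_cases h : m ∈ (v b).support
  · rw [hv b m h]
    split_ifs <;> simp
  · have : coeff m (v b) = 0 := by simpa using h
    split_ifs <;> simp [this]

theorem isHomogeneousVector_single (deg : ι → ℕ) (b : ι) (m : Fin n →₀ ℕ) (c : k) :
    IsHomogeneousVector deg (deg b + m.degree) (Finsupp.single b (monomial m c)) := by
  classical
  intro b' m' hm'
  by_cases h : b = b'
  · subst h
    rw [Finsupp.single_eq_same] at hm'
    rw [Finset.mem_singleton.1 (support_monomial_subset hm')]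
  · simp [h] at hm'

theorem IsGradedMap.map_vectorComponent {degι : ι → ℕ} {degκ : κ → ℕ}
    {f : (ι →₀ MvPolynomial (Fin n) k) →ₗ[MvPolynomial (Fin n) k]
      (κ →₀ MvPolynomial (Fin n) k)} (hf : IsGradedMap degι degκ f) (e : ℕ)
    (v : ι →₀ MvPolynomial (Fin n) k) :
    f (vectorComponent degι e v) = vectorComponent degκ e (f v) := by
  induction v using Finsupp.induction_linear with
  | zero => simp
  | add v w hv hw => simp only [map_add, hv, hw]
  | single b p =>
    induction p using MvPolynomial.induction_on' with
    | monomial m c =>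
      have h := isHomogeneousVector_single degι b m c
      rw [h.vectorComponent, (hf.apply h).vectorComponent]
      split_ifs <;> simp
    | add p q hp hq => simp only [Finsupp.single_add, map_add, hp, hq]

/-- Graded maps commute with homogeneous components, so the degree `e` component of any preimage is
still a preimage. -/
theorem IsGradedMap.exists_homogeneous_preimage {degι : ι → ℕ} {degκ : κ → ℕ}
    {f : (ι →₀ MvPolynomial (Fin n) k) →ₗ[MvPolynomial (Fin n) k]
      (κ →₀ MvPolynomial (Fin n) k)} (hf : IsGradedMap degι degκ f) {e : ℕ}
    {v : κ →₀ MvPolynomial (Fin n) k} (hv : IsHomogeneousVector degκ e v)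
    (hr : v ∈ LinearMap.range f) : ∃ w, IsHomogeneousVector degι e w ∧ f w = v := by
  obtain ⟨w, rfl⟩ := hr
  refine ⟨vectorComponent degι e w, isHomogeneousVector_vectorComponent _ _ _, ?_⟩
  rw [hf.map_vectorComponent, hv.vectorComponent, if_pos rfl]

/-- A graded map into a graded free module lifts along a graded map whose range contains its
range. -/
theorem IsGradedMap.exists_lift {degι : ι → ℕ} {degκ : κ → ℕ} {degτ : τ → ℕ}
    {f : (ι →₀ MvPolynomial (Fin n) k) →ₗ[MvPolynomial (Fin n) k]
      (κ →₀ MvPolynomial (Fin n) k)} (hf : IsGradedMap degι degκ f)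
    {g : (τ →₀ MvPolynomial (Fin n) k) →ₗ[MvPolynomial (Fin n) k]
      (κ →₀ MvPolynomial (Fin n) k)} (hg : IsGradedMap degτ degκ g)
    (h : ∀ v, g v ∈ LinearMap.range f) :
    ∃ φ : (τ →₀ MvPolynomial (Fin n) k) →ₗ[MvPolynomial (Fin n) k]
      (ι →₀ MvPolynomial (Fin n) k), IsGradedMap degτ degι φ ∧ f ∘ₗ φ = g := by
  choose w hw hfw using fun b => hf.exists_homogeneous_preimage (hg b) (h (Finsupp.single b 1))
  refine ⟨Finsupp.linearCombination _ w, fun b => ?_, ?_⟩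
  · simpa using hw b
  · refine Finsupp.lhom_ext' fun b => LinearMap.ext_ring ?_
    simpa using hfw b

/-- Freeness: a map out of `ι →₀ R` lifts along any linear map whose range contains its range. -/
theorem exists_linear_lift {M N : Type*} [AddCommGroup M] [AddCommGroup N]
    [Module (MvPolynomial (Fin n) k) M] [Module (MvPolynomial (Fin n) k) N]
    (f : M →ₗ[MvPolynomial (Fin n) k] N)
    (g : (τ →₀ MvPolynomial (Fin n) k) →ₗ[MvPolynomial (Fin n) k] N)
    (h : ∀ v, g v ∈ LinearMap.range f) :
    ∃ φ : (τ →₀ MvPolynomial (Fin n) k) →ₗ[MvPolynomial (Fin n) k] M, f ∘ₗ φ = g := by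
  choose w hw using fun b => h (Finsupp.single b 1)
  refine ⟨Finsupp.linearCombination _ w, Finsupp.lhom_ext' fun b => LinearMap.ext_ring ?_⟩
  simpa using hw b

end GradedVectors

/-! ### Comparison of resolutions -/

namespace MinimalGradedFreeResolution

variable {k : Type*} [Field k] {n : ℕ} {I I' : Ideal (MvPolynomial (Fin n) k)}

/-- The augmentation as a map to the free module of rank one. -/
noncomputable def augVector (F : MinimalGradedFreeResolution I) :
    (F.idx 0 →₀ MvPolynomial (Fin n) k) →ₗ[MvPolynomial (Fin n) k]
      (Unit →₀ MvPolynomial (Fin n) k) :=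
  Finsupp.lsingle () ∘ₗ I.subtype ∘ₗ F.aug

theorem augVector_apply (F : MinimalGradedFreeResolution I)
    (v : F.idx 0 →₀ MvPolynomial (Fin n) k) :
    F.augVector v = Finsupp.single () (F.aug v : MvPolynomial (Fin n) k) := rfl

theorem isGradedMap_augVector (F : MinimalGradedFreeResolution I) :
    IsGradedMap (F.deg 0) (fun _ => 0) F.augVector := by
  intro b u m hm
  rw [augVector_apply, Finsupp.single_eq_same] at hm
  rw [zero_add]
  exact degree_of_mem_support (F.aug_graded b) hm

theorem mem_range_d_zero (F : MinimalGradedFreeResolution I)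
    {v : F.idx 0 →₀ MvPolynomial (Fin n) k} :
    v ∈ LinearMap.range (F.d 0) ↔ F.aug v = 0 :=
  (F.exact_zero v).symm

theorem mem_range_d_succ (F : MinimalGradedFreeResolution I) {i : ℕ}
    {v : F.idx (i + 1) →₀ MvPolynomial (Fin n) k} :
    v ∈ LinearMap.range (F.d (i + 1)) ↔ F.d i v = 0 :=
  (F.exact_succ i v).symm

theorem aug_d (F : MinimalGradedFreeResolution I)
    (v : F.idx 1 →₀ MvPolynomial (Fin n) k) : F.aug (F.d 0 v) = 0 :=
  F.mem_range_d_zero.1 ⟨v, rfl⟩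

theorem d_d (F : MinimalGradedFreeResolution I) (i : ℕ)
    (v : F.idx (i + 2) →₀ MvPolynomial (Fin n) k) : F.d i (F.d (i + 1) v) = 0 :=
  F.mem_range_d_succ.1 ⟨v, rfl⟩

/-- The comparison theorem for graded free resolutions. -/
theorem exists_comparison (F : MinimalGradedFreeResolution I)
    (G : MinimalGradedFreeResolution I') (h : I ≤ I') :
    ∃ φ : ∀ i, (F.idx i →₀ MvPolynomial (Fin n) k) →ₗ[MvPolynomial (Fin n) k]
        (G.idx i →₀ MvPolynomial (Fin n) k),
      (∀ i, IsGradedMap (F.deg i) (G.deg i) (φ i)) ∧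
      (∀ v, (G.aug (φ 0 v) : MvPolynomial (Fin n) k) = F.aug v) ∧
      ∀ i v, G.d i (φ (i + 1) v) = φ i (F.d i v) := by
  -- Each map is stored with the range condition that allows the next lift; this makes the recursion
  -- possible.
  let S : ℕ → Type _ := fun i =>
    {φ : (F.idx i →₀ MvPolynomial (Fin n) k) →ₗ[MvPolynomial (Fin n) k]
      (G.idx i →₀ MvPolynomial (Fin n) k) //
      IsGradedMap (F.deg i) (G.deg i) φ ∧ ∀ v, φ (F.d i v) ∈ LinearMap.range (G.d i)}
  have h0 : ∃ s : S 0, ∀ v, (G.aug (s.1 v) : MvPolynomial (Fin n) k) = F.aug v := by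
    -- Viewed as maps into the free module of rank one, the augmentations fall under the same graded
    -- lifting lemma as the differentials.
    obtain ⟨φ, hφ, hc⟩ := G.isGradedMap_augVector.exists_lift F.isGradedMap_augVector (fun v => by
      obtain ⟨w, hw⟩ := G.aug_surjective ⟨F.aug v, h (F.aug v).2⟩
      exact ⟨w, by rw [augVector_apply, augVector_apply, hw]⟩)
    have hc' : ∀ v, (G.aug (φ v) : MvPolynomial (Fin n) k) = F.aug v := fun v => by
      have := LinearMap.congr_fun hc v
      rw [LinearMap.comp_apply, augVector_apply, augVector_apply] at this
      exact Finsupp.single_injective _ this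
    refine ⟨⟨φ, hφ, fun v => ?_⟩, hc'⟩
    rw [mem_range_d_zero, ← Submodule.coe_eq_zero, hc', aug_d, Submodule.coe_zero]
  have hs : ∀ i (s : S i), ∃ t : S (i + 1), ∀ v, G.d i (t.1 v) = s.1 (F.d i v) := by
    intro i s
    have hg : IsGradedMap (F.deg (i + 1)) (G.deg i) (s.1 ∘ₗ F.d i) :=
      fun b => s.2.1.apply (F.d_graded i b)
    obtain ⟨φ, hφ, hc⟩ := IsGradedMap.exists_lift (f := G.d i) (G.d_graded i) hg s.2.2
    have hc' := LinearMap.congr_fun hc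
    refine ⟨⟨φ, hφ, fun v => ?_⟩, hc'⟩
    rw [mem_range_d_succ]
    refine (hc' _).trans ?_
    rw [LinearMap.comp_apply, d_d, map_zero]
  obtain ⟨s0, h0⟩ := h0
  choose t ht using hs
  let s : ∀ i, S i := fun i => Nat.rec s0 t i
  exact ⟨fun i => (s i).1, fun i => (s i).2.1, h0, fun i v => ht i (s i) v⟩

end MinimalGradedFreeResolution

/-! ### Reduction modulo the graded maximal ideal -/

section MaximalIdeal

variable {k : Type*} [Field k] {n : ℕ} {ι κ τ : Type*}

theorem constantCoeff_of_mem_gradedMaximalIdeal {p : MvPolynomial (Fin n) k}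
    (hp : p ∈ gradedMaximalIdeal k n) : constantCoeff p = 0 := by
  have : gradedMaximalIdeal k n ≤ RingHom.ker (constantCoeff (R := k) (σ := Fin n)) := by
    refine Ideal.span_le.2 ?_
    rintro _ ⟨j, rfl⟩
    simp [RingHom.mem_ker]
  exact this hp

theorem mem_gradedMaximalIdeal_of_isHomogeneous {p : MvPolynomial (Fin n) k}
    (hp : p.IsHomogeneous 1) : p ∈ gradedMaximalIdeal k n := by
  rw [gradedMaximalIdeal, ← Set.image_univ, mem_ideal_span_X_image]
  intro m hm
  by_contra! h
  have hm0 : m = 0 := Finsupp.ext fun i => by simpa using h i (Set.mem_univ i)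
  have := degree_of_mem_support hp hm
  simp [hm0] at this

theorem constantCoeff_of_mem_smul_top {v : ι →₀ MvPolynomial (Fin n) k}
    (hv : v ∈ gradedMaximalIdeal k n • (⊤ : Submodule (MvPolynomial (Fin n) k)
      (ι →₀ MvPolynomial (Fin n) k))) (b : ι) : constantCoeff (v b) = 0 := by
  induction hv using Submodule.smul_induction_on' with
  | smul p hp w _ => simp [constantCoeff_of_mem_gradedMaximalIdeal hp]
  | add v _ w _ hv hw => simp [hv, hw]

theorem mem_smul_top_of_forall {v : ι →₀ MvPolynomial (Fin n) k}
    (hv : ∀ b, v b ∈ gradedMaximalIdeal k n) :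
    v ∈ gradedMaximalIdeal k n • (⊤ : Submodule (MvPolynomial (Fin n) k)
      (ι →₀ MvPolynomial (Fin n) k)) := by
  rw [← v.sum_single]
  refine Submodule.sum_mem _ fun b _ => ?_
  rw [← Finsupp.smul_single_one]
  exact Submodule.smul_mem_smul (hv b) trivial

theorem constantCoeff_map_apply [Fintype ι] (f : (ι →₀ MvPolynomial (Fin n) k)
      →ₗ[MvPolynomial (Fin n) k] (κ →₀ MvPolynomial (Fin n) k))
    (v : ι →₀ MvPolynomial (Fin n) k) (c : κ) :
    constantCoeff (f v c) =
      ∑ b, constantCoeff (f (Finsupp.single b 1) c) * constantCoeff (v b) := by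
  have : f v = ∑ b, v b • f (Finsupp.single b 1) := by
    conv_lhs => rw [← v.sum_single, Finsupp.sum_fintype _ _ (by simp)]
    rw [map_sum]
    refine Finset.sum_congr rfl fun b _ => ?_
    rw [← map_smul, Finsupp.smul_single_one]
  rw [this, Finsupp.finsetSum_apply, map_sum]
  refine Finset.sum_congr rfl fun b _ => ?_
  rw [Finsupp.smul_apply, smul_eq_mul, map_mul, mul_comm]

theorem IsGradedMap.constantCoeff_eq_zero {degι : ι → ℕ} {degκ : κ → ℕ}
    {f : (ι →₀ MvPolynomial (Fin n) k) →ₗ[MvPolynomial (Fin n) k]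
      (κ →₀ MvPolynomial (Fin n) k)} (hf : IsGradedMap degι degκ f) {b : ι} {c : κ}
    (h : degκ c ≠ degι b) : constantCoeff (f (Finsupp.single b 1) c) = 0 := by
  by_contra h0
  rw [constantCoeff_eq] at h0
  exact h (by simpa using hf b c 0 (mem_support_iff.2 h0))

/-- Constant coefficients turn `f` and `g` into matrices over `k` with $gf=1$. As `f` is graded, its
matrix has no entries between different degrees, so its degree `j` block has a left inverse and is
injective. No grading of `g` is needed. -/
theorem card_le_of_comp_congr_id [Finite ι] [Finite κ] {degι : ι → ℕ} {degκ : κ → ℕ}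
    {f : (ι →₀ MvPolynomial (Fin n) k) →ₗ[MvPolynomial (Fin n) k]
      (κ →₀ MvPolynomial (Fin n) k)}
    {g : (κ →₀ MvPolynomial (Fin n) k) →ₗ[MvPolynomial (Fin n) k]
      (ι →₀ MvPolynomial (Fin n) k)} (hf : IsGradedMap degι degκ f)
    (h : ∀ v, g (f v) - v ∈ gradedMaximalIdeal k n • (⊤ : Submodule (MvPolynomial (Fin n) k)
      (ι →₀ MvPolynomial (Fin n) k))) (j : ℕ) :
    Nat.card {b : ι // degι b = j} ≤ Nat.card {c : κ // degκ c = j} := by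
  classical
  have := Fintype.ofFinite ι
  have := Fintype.ofFinite κ
  let A : Matrix {b : ι // degι b = j} {c : κ // degκ c = j} k :=
    Matrix.of fun b c => constantCoeff (g (Finsupp.single c.1 1) b.1)
  let B : Matrix {c : κ // degκ c = j} {b : ι // degι b = j} k :=
    Matrix.of fun c b => constantCoeff (f (Finsupp.single b.1 1) c.1)
  have hAB : A * B = 1 := by
    ext b b'
    have h1 := constantCoeff_of_mem_smul_top (h (Finsupp.single b'.1 1)) b.1
    rw [Finsupp.sub_apply, map_sub, sub_eq_zero, constantCoeff_map_apply] at h1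
    rw [Matrix.mul_apply, Matrix.one_apply]
    have h2 : ∑ c : {c : κ // degκ c = j}, A b c * B c b' =
        ∑ c, constantCoeff (g (Finsupp.single c 1) b.1) *
          constantCoeff (f (Finsupp.single b'.1 1) c) := by
      refine Fintype.sum_of_injective _ Subtype.coe_injective _ _ (fun c hc => ?_) fun c => rfl
      have hc' : degκ c ≠ degι b'.1 := fun hcb => hc ⟨⟨c, hcb.trans b'.2⟩, rfl⟩
      rw [hf.constantCoeff_eq_zero hc', mul_zero]
    rw [h2, h1, Finsupp.single_apply]
    by_cases hb : b = b'
    · simp [hb]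
    · simp [hb, Ne.symm hb, Subtype.coe_injective.eq_iff]
  have hinj : Function.Injective (Matrix.toLin' B) := by
    intro x y hxy
    have := congrArg (Matrix.toLin' A) hxy
    simpa [← Matrix.toLin'_mul_apply, hAB] using this
  have := LinearMap.finrank_le_finrank_of_injective hinj
  simpa [Nat.card_eq_fintype_card] using this

end MaximalIdeal

/-! ### Independence of the graded Betti numbers from the resolution -/

namespace MinimalGradedFreeResolution

variable {k : Type*} [Field k] {n : ℕ} {I : Ideal (MvPolynomial (Fin n) k)}

/-- A chain endomorphism of a minimal resolution lifting zero vanishes modulo the graded maximal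
ideal. -/
theorem mem_smul_top_of_lift_zero (F : MinimalGradedFreeResolution I)
    (χ : ∀ i, (F.idx i →₀ MvPolynomial (Fin n) k) →ₗ[MvPolynomial (Fin n) k]
      (F.idx i →₀ MvPolynomial (Fin n) k))
    (h0 : ∀ v, F.aug (χ 0 v) = 0) (hd : ∀ i v, F.d i (χ (i + 1) v) = χ i (F.d i v)) (i : ℕ)
    (v : F.idx i →₀ MvPolynomial (Fin n) k) :
    χ i v ∈ gradedMaximalIdeal k n • (⊤ : Submodule (MvPolynomial (Fin n) k)
      (F.idx i →₀ MvPolynomial (Fin n) k)) := by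
  -- A null-homotopy, one degree at a time. The first property makes the next lift possible. The
  -- second holds because $\chi-dh$ is zero or the previous homotopy applied to $dv$, which lies in
  -- $\mathfrak m F$ by minimality.
  have key : ∀ i, ∃ h : (F.idx i →₀ MvPolynomial (Fin n) k) →ₗ[MvPolynomial (Fin n) k]
      (F.idx (i + 1) →₀ MvPolynomial (Fin n) k),
      (∀ v, F.d i (h (F.d i v)) = χ i (F.d i v)) ∧
      ∀ v, χ i v - F.d i (h v) ∈ gradedMaximalIdeal k n •
        (⊤ : Submodule (MvPolynomial (Fin n) k) (F.idx i →₀ MvPolynomial (Fin n) k)) := by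
    intro i
    induction i with
    | zero =>
      obtain ⟨h, hh⟩ := exists_linear_lift (F.d 0) (χ 0) fun v => F.mem_range_d_zero.2 (h0 v)
      have hh := LinearMap.congr_fun hh
      simp only [LinearMap.comp_apply] at hh
      refine ⟨h, fun v => hh _, fun v => ?_⟩
      rw [hh, sub_self]
      exact zero_mem _
    | succ i ih =>
      obtain ⟨h, hh, -⟩ := ih
      obtain ⟨h', hh'⟩ := exists_linear_lift (F.d (i + 1)) (χ (i + 1) - h ∘ₗ F.d i) fun v => by
        rw [mem_range_d_succ, LinearMap.sub_apply, map_sub, LinearMap.comp_apply, hh, hd,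
          sub_self]
      have hh' := LinearMap.congr_fun hh'
      simp only [LinearMap.comp_apply, LinearMap.sub_apply] at hh'
      refine ⟨h', fun v => ?_, fun v => ?_⟩
      · rw [hh', d_d, map_zero, sub_zero]
      · rw [hh', sub_sub_cancel]
        have h1 := F.minimal i ⟨v, rfl⟩
        have h2 := Submodule.mem_map_of_mem (f := h) h1
        rw [Submodule.map_smul''] at h2
        exact Submodule.smul_mono le_rfl le_top h2
  obtain ⟨h, -, hh⟩ := key i
  have := add_mem (hh v) (F.minimal i ⟨h v, rfl⟩)
  rwa [sub_add_cancel] at this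

theorem betti_le (F G : MinimalGradedFreeResolution I) (i j : ℕ) : F.betti i j ≤ G.betti i j := by
  obtain ⟨φ, hφ, hφ0, hφd⟩ := F.exists_comparison G le_rfl
  obtain ⟨ψ, hψ, hψ0, hψd⟩ := G.exists_comparison F le_rfl
  have := F.finite_idx i
  have := G.finite_idx i
  refine card_le_of_comp_congr_id (hφ i) (g := ψ i) (fun v => ?_) j
  -- Both $\psi\varphi$ and the identity lift the identity of `I`, so their difference lifts zero.
  refine F.mem_smul_top_of_lift_zero (fun i => ψ i ∘ₗ φ i - LinearMap.id)
    (fun v => ?_) (fun i v => ?_) i v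
  · rw [LinearMap.sub_apply, map_sub, sub_eq_zero]
    exact Subtype.ext ((hψ0 _).trans (hφ0 v))
  · simp [hψd, hφd]

/-- The graded Betti numbers do not depend on the minimal resolution. -/
theorem betti_eq (F G : MinimalGradedFreeResolution I) (i j : ℕ) : F.betti i j = G.betti i j :=
  le_antisymm (F.betti_le G i j) (G.betti_le F i j)

end MinimalGradedFreeResolution

/-! ### Linear resolutions and the base cases -/

section LinearResolutions

variable {k : Type*} [Field k] {n : ℕ}

/-- `I` has a minimal graded free resolution whose `i`-th module is `R(-(i + a))` to the power
given by the `i`-th coefficient of `B`. -/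
def HasLinearBetti (I : Ideal (MvPolynomial (Fin n) k)) (a : ℕ) (B : PowerSeries ℕ) : Prop :=
  ∃ F : MinimalGradedFreeResolution I, (∀ i b, F.deg i b = i + a) ∧
    ∀ i, Nat.card (F.idx i) = PowerSeries.coeff i B

/-- With basis degrees $i+a$, differentials whose entries are linear forms are at once graded of
degree zero and minimal. -/
theorem HasLinearBetti.of_complex {I : Ideal (MvPolynomial (Fin n) k)} {a : ℕ}
    {B : PowerSeries ℕ} (idx : ℕ → Type) [∀ i, Finite (idx i)]
    (d : ∀ i, (idx (i + 1) →₀ MvPolynomial (Fin n) k) →ₗ[MvPolynomial (Fin n) k]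
      (idx i →₀ MvPolynomial (Fin n) k))
    (aug : (idx 0 →₀ MvPolynomial (Fin n) k) →ₗ[MvPolynomial (Fin n) k] I)
    (hd : ∀ i b c, (d i (Finsupp.single b 1) c).IsHomogeneous 1)
    (haug : ∀ b, (aug (Finsupp.single b 1) : MvPolynomial (Fin n) k).IsHomogeneous a)
    (hsurj : Function.Surjective aug) (h0 : Function.Exact (d 0) aug)
    (hs : ∀ i, Function.Exact (d (i + 1)) (d i))
    (hB : ∀ i, Nat.card (idx i) = PowerSeries.coeff i B) : HasLinearBetti I a B := by
  refine ⟨⟨idx, inferInstance, fun i _ => i + a, d, aug, fun i b c m hm => ?_, fun b => ?_,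
    hsurj, h0, hs, fun i => ?_⟩, fun _ _ => rfl, hB⟩
  · rw [degree_of_mem_support (hd i b c) hm, add_right_comm]
  · simpa using haug b
  · rintro _ ⟨v, rfl⟩
    rw [← v.sum_single, Finsupp.sum, map_sum]
    refine Submodule.sum_mem _ fun b _ => ?_
    rw [← Finsupp.smul_single_one, map_smul]
    exact Submodule.smul_mem _ _
      (mem_smul_top_of_forall fun c => mem_gradedMaximalIdeal_of_isHomogeneous (hd i b c))

theorem hasLinearBetti_bot (a : ℕ) :
    HasLinearBetti (⊥ : Ideal (MvPolynomial (Fin n) k)) a 0 := by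
  refine .of_complex (fun _ => Empty) (fun _ => 0) 0 (fun _ b => b.elim) (fun b => b.elim)
    (fun y => ⟨0, Subsingleton.elim _ _⟩) (fun y => ?_) (fun i y => ?_) (by simp)
  · simp [Subsingleton.elim y 0]
  · simp [Subsingleton.elim y 0]

theorem hasLinearBetti_top :
    HasLinearBetti (⊤ : Ideal (MvPolynomial (Fin n) k)) 0 1 := by
  let aug : (PLift (0 = 0) →₀ MvPolynomial (Fin n) k) →ₗ[MvPolynomial (Fin n) k]
      (⊤ : Ideal (MvPolynomial (Fin n) k)) :=
    (Finsupp.lapply ⟨rfl⟩).codRestrict ⊤ fun _ => trivial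
  have hcoe : ∀ v, (aug v : MvPolynomial (Fin n) k) = v ⟨rfl⟩ := fun v => rfl
  -- `PLift (i = 0)` has one point for $i=0$ and none otherwise: the complex is $R$ in position 0.
  refine .of_complex (fun i => PLift (i = 0)) (fun _ => 0) aug (fun _ b => absurd b.down (by simp))
    (fun b => ?_) (fun y => ⟨Finsupp.single ⟨rfl⟩ y, ?_⟩) (fun y => ?_) (fun i y => ?_)
    (fun i => ?_)
  · rw [hcoe, Subsingleton.elim b ⟨rfl⟩, Finsupp.single_eq_same]
    exact isHomogeneous_one _ _
  · exact Subtype.ext (by rw [hcoe, Finsupp.single_eq_same])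
  · rw [← Submodule.coe_eq_zero, hcoe]
    constructor
    · intro h
      refine ⟨0, ?_⟩
      ext b
      rw [Subsingleton.elim b ⟨rfl⟩, h]
      simp
    · rintro ⟨v, rfl⟩
      simp
  · have : IsEmpty (PLift (i + 1 = 0)) := ⟨fun b => absurd b.down (by simp)⟩
    simp [Subsingleton.elim y 0]
  · rw [PowerSeries.coeff_one]
    split_ifs with h
    · subst h
      simp
    · have : IsEmpty (PLift (i = 0)) := ⟨fun b => h b.down⟩
      simp

end LinearResolutions

/-! ### The mapping cone -/

section MappingCone

variable {k : Type*} [Field k] {n : ℕ}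

/-- The family of index sets `idx`, shifted up by one. -/
def shiftedIdx (idx : ℕ → Type) : ℕ → Type
  | 0 => Empty
  | i + 1 => idx i

instance finite_shiftedIdx (idx : ℕ → Type) [∀ i, Finite (idx i)] (i : ℕ) :
    Finite (shiftedIdx idx i) := by
  cases i
  · exact inferInstanceAs (Finite Empty)
  · exact inferInstanceAs (Finite (idx _))

/-- A shifted free module in a positive position. -/
noncomputable def unshift (k : Type*) [Field k] (n : ℕ) (idx : ℕ → Type) (i : ℕ) :
    (shiftedIdx idx (i + 1) →₀ MvPolynomial (Fin n) k) ≃ₗ[MvPolynomial (Fin n) k]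
      (idx i →₀ MvPolynomial (Fin n) k) :=
  LinearEquiv.refl _ _

theorem exists_unshift_single (idx : ℕ → Type) (i : ℕ) (b : shiftedIdx idx (i + 1)) :
    ∃ b' : idx i, unshift k n idx i (Finsupp.single b 1) = Finsupp.single b' 1 :=
  ⟨b, rfl⟩

/-- The free module on a disjoint union of three sets as a product. -/
noncomputable def sumProdEquiv (k : Type*) [Field k] (n : ℕ) (ι κ τ : Type*) :
    (ι ⊕ κ ⊕ τ →₀ MvPolynomial (Fin n) k) ≃ₗ[MvPolynomial (Fin n) k]
      (ι →₀ MvPolynomial (Fin n) k) × (κ →₀ MvPolynomial (Fin n) k) ×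
        (τ →₀ MvPolynomial (Fin n) k) :=
  (Finsupp.sumFinsuppLEquivProdFinsupp _).trans
    (LinearEquiv.prodCongr (LinearEquiv.refl _ _) (Finsupp.sumFinsuppLEquivProdFinsupp _))

section

variable {ι κ τ : Type*}

@[simp]
theorem sumProdEquiv_single_inl (b : ι) :
    sumProdEquiv k n ι κ τ (Finsupp.single (Sum.inl b) 1) = (Finsupp.single b 1, 0, 0) := by
  classical
  ext <;> simp [sumProdEquiv, Finsupp.single_apply]

@[simp]
theorem sumProdEquiv_single_inr_inl (b : κ) :
    sumProdEquiv k n ι κ τ (Finsupp.single (Sum.inr (Sum.inl b)) 1) =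
      (0, Finsupp.single b 1, 0) := by
  classical
  ext <;> simp [sumProdEquiv, Finsupp.single_apply]

@[simp]
theorem sumProdEquiv_single_inr_inr (b : τ) :
    sumProdEquiv k n ι κ τ (Finsupp.single (Sum.inr (Sum.inr b)) 1) =
      (0, 0, Finsupp.single b 1) := by
  classical
  ext <;> simp [sumProdEquiv, Finsupp.single_apply]

theorem isHomogeneous_sumProdEquiv_symm {e : ℕ}
    {v : (ι →₀ MvPolynomial (Fin n) k) × (κ →₀ MvPolynomial (Fin n) k) ×
        (τ →₀ MvPolynomial (Fin n) k)} (h1 : ∀ b, (v.1 b).IsHomogeneous e)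
    (h2 : ∀ b, (v.2.1 b).IsHomogeneous e) (h3 : ∀ b, (v.2.2 b).IsHomogeneous e)
    (c : ι ⊕ κ ⊕ τ) : ((sumProdEquiv k n ι κ τ).symm v c).IsHomogeneous e := by
  rcases c with c | c | c
  · simpa [sumProdEquiv] using h1 c
  · simpa [sumProdEquiv] using h2 c
  · simpa [sumProdEquiv] using h3 c

end

namespace MinimalGradedFreeResolution

variable {I A B : Ideal (MvPolynomial (Fin n) k)}

/-- The differential of the resolution, shifted up by one. -/
noncomputable def shiftedD (F : MinimalGradedFreeResolution I) :
    ∀ i, (F.idx i →₀ MvPolynomial (Fin n) k) →ₗ[MvPolynomial (Fin n) k]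
      (shiftedIdx F.idx i →₀ MvPolynomial (Fin n) k)
  | 0 => 0
  | i + 1 => F.d i

theorem isHomogeneous_d_of_linear (F : MinimalGradedFreeResolution I) {a : ℕ}
    (hF : ∀ i b, F.deg i b = i + a) (i : ℕ) (b : F.idx (i + 1)) (c : F.idx i) :
    (F.d i (Finsupp.single b 1) c).IsHomogeneous 1 := by
  refine isHomogeneous_of_degree fun m hm => ?_
  have := F.d_graded i b c m hm
  rw [hF, hF] at this
  omega

theorem isHomogeneous_shiftedD_of_linear (F : MinimalGradedFreeResolution I) {a : ℕ}
    (hF : ∀ i b, F.deg i b = i + a) (i : ℕ) (b : F.idx i) (c : shiftedIdx F.idx i) :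
    (F.shiftedD i (Finsupp.single b 1) c).IsHomogeneous 1 := by
  cases i with
  | zero => exact c.elim
  | succ i => exact F.isHomogeneous_d_of_linear hF i b c

theorem shiftedD_succ (F : MinimalGradedFreeResolution I) (i : ℕ)
    (v : F.idx (i + 1) →₀ MvPolynomial (Fin n) k) :
    F.shiftedD (i + 1) v = (unshift k n F.idx i).symm (F.d i v) := rfl

/-- The differential of the mapping cone of `(x, -φ) : F → F ⊕ G`, on triples. -/
noncomputable def coneD (F : MinimalGradedFreeResolution A) (G : MinimalGradedFreeResolution B)
    (φ : ∀ i, (F.idx i →₀ MvPolynomial (Fin n) k) →ₗ[MvPolynomial (Fin n) k]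
        (G.idx i →₀ MvPolynomial (Fin n) k)) (x : MvPolynomial (Fin n) k) (i : ℕ) :
    ((F.idx (i + 1) →₀ MvPolynomial (Fin n) k) × (G.idx (i + 1) →₀ MvPolynomial (Fin n) k) ×
      (shiftedIdx F.idx (i + 1) →₀ MvPolynomial (Fin n) k)) →ₗ[MvPolynomial (Fin n) k]
    ((F.idx i →₀ MvPolynomial (Fin n) k) × (G.idx i →₀ MvPolynomial (Fin n) k) ×
      (shiftedIdx F.idx i →₀ MvPolynomial (Fin n) k)) :=
  let p := (unshift k n F.idx i).toLinearMap ∘ₗ LinearMap.snd _ _ _ ∘ₗ LinearMap.snd _ _ _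
  (F.d i ∘ₗ LinearMap.fst _ _ _ + x • p).prod
    ((G.d i ∘ₗ LinearMap.fst _ _ _ ∘ₗ LinearMap.snd _ _ _ - φ i ∘ₗ p).prod
      (-(F.shiftedD i ∘ₗ p)))

theorem coneD_apply (F : MinimalGradedFreeResolution A) (G : MinimalGradedFreeResolution B)
    (φ : ∀ i, (F.idx i →₀ MvPolynomial (Fin n) k) →ₗ[MvPolynomial (Fin n) k]
        (G.idx i →₀ MvPolynomial (Fin n) k)) (x : MvPolynomial (Fin n) k) (i : ℕ) (f g f') :
    coneD F G φ x i (f, g, f') =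
      (F.d i f + x • unshift k n F.idx i f', G.d i g - φ i (unshift k n F.idx i f'),
        -F.shiftedD i (unshift k n F.idx i f')) := rfl

/-- In a cycle $(f,g,f')$ the entry $f'$ is a boundary $df''$; then $f+xf''$ and $g-\varphi f''$ are
cycles of `F` and `G`, hence boundaries. -/
theorem coneD_exact {F : MinimalGradedFreeResolution A} {G : MinimalGradedFreeResolution B}
    {φ : ∀ i, (F.idx i →₀ MvPolynomial (Fin n) k) →ₗ[MvPolynomial (Fin n) k]
        (G.idx i →₀ MvPolynomial (Fin n) k)}
    (hφ : ∀ i v, G.d i (φ (i + 1) v) = φ i (F.d i v)) {x : MvPolynomial (Fin n) k} (hx : x ≠ 0)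
    (i : ℕ) : Function.Exact (coneD F G φ x (i + 1)) (coneD F G φ x i) := by
  rintro ⟨f, g, f'⟩
  constructor
  · intro h
    rw [coneD_apply, Prod.mk_eq_zero, Prod.mk_eq_zero, neg_eq_zero, sub_eq_zero] at h
    obtain ⟨h1, h2, h3⟩ := h
    obtain ⟨f'', hf''⟩ : ∃ f'', F.d i f'' = unshift k n F.idx i f' := by
      cases i with
      | zero =>
        -- The third component is void here, as its target is the zero module. Instead, augmenting
        -- the first component gives $x\cdot\mathrm{aug}(f')=0$, and $x\ne 0$ in a domain.
        rw [← LinearMap.mem_range, F.mem_range_d_zero]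
        have h4 := congrArg F.aug h1
        rw [map_add, aug_d, zero_add, map_smul, map_zero] at h4
        exact (smul_eq_zero.1 h4).resolve_left hx
      | succ i =>
        rw [shiftedD_succ, LinearEquiv.map_eq_zero_iff] at h3
        exact F.mem_range_d_succ.2 h3
    obtain ⟨u, hu⟩ : f + x • f'' ∈ LinearMap.range (F.d (i + 1)) := by
      rw [F.mem_range_d_succ, map_add, map_smul, hf'', h1]
    obtain ⟨v, hv⟩ : g - φ (i + 1) f'' ∈ LinearMap.range (G.d (i + 1)) := by
      rw [G.mem_range_d_succ, map_sub, hφ, hf'', h2, sub_self]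
    refine ⟨(u, v, (unshift k n F.idx (i + 1)).symm (-f'')), ?_⟩
    rw [coneD_apply, LinearEquiv.apply_symm_apply, hu, hv, shiftedD_succ, map_neg, map_neg, hf'',
      map_neg, neg_neg, LinearEquiv.symm_apply_apply, smul_neg, add_neg_cancel_right,
      sub_neg_eq_add, sub_add_cancel]
  · rintro ⟨⟨u, v, w⟩, h⟩
    rw [coneD_apply, shiftedD_succ, Prod.mk.injEq, Prod.mk.injEq] at h
    obtain ⟨rfl, rfl, rfl⟩ := h
    rw [coneD_apply, Prod.mk_eq_zero, Prod.mk_eq_zero, map_neg, LinearEquiv.apply_symm_apply]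
    refine ⟨?_, ?_, ?_⟩
    · rw [map_add, d_d, map_smul, smul_neg, zero_add, add_neg_cancel]
    · rw [map_sub, d_d, hφ, map_neg, zero_sub, sub_neg_eq_add, neg_add_cancel]
    · cases i with
      | zero => simp [shiftedD]
      | succ i => rw [shiftedD_succ, map_neg, d_d, neg_zero, map_zero, neg_zero]

/-- The augmentation of the mapping cone, on triples. -/
noncomputable def coneAug (F : MinimalGradedFreeResolution A) (G : MinimalGradedFreeResolution B)
    (x : MvPolynomial (Fin n) k) (hI : I = A ⊔ Ideal.span {x} * B) :
    ((F.idx 0 →₀ MvPolynomial (Fin n) k) × (G.idx 0 →₀ MvPolynomial (Fin n) k) ×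
      (shiftedIdx F.idx 0 →₀ MvPolynomial (Fin n) k)) →ₗ[MvPolynomial (Fin n) k] I :=
  ((A.subtype ∘ₗ F.aug).coprod
    ((x • B.subtype ∘ₗ G.aug) ∘ₗ LinearMap.fst _ _ _)).codRestrict I fun v => by
      rw [hI]
      exact add_mem (Ideal.mem_sup_left (F.aug v.1).2) (Ideal.mem_sup_right
        (Ideal.mul_mem_mul (Ideal.mem_span_singleton_self x) (G.aug v.2.1).2))

theorem coneAug_apply (F : MinimalGradedFreeResolution A) (G : MinimalGradedFreeResolution B)
    (x : MvPolynomial (Fin n) k) (hI : I = A ⊔ Ideal.span {x} * B) (f g f') :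
    (coneAug F G x hI (f, g, f') : MvPolynomial (Fin n) k) = F.aug f + x * G.aug g := rfl

theorem coneAug_surjective (F : MinimalGradedFreeResolution A)
    (G : MinimalGradedFreeResolution B) (x : MvPolynomial (Fin n) k)
    (hI : I = A ⊔ Ideal.span {x} * B) : Function.Surjective (coneAug F G x hI) := by
  rintro ⟨p, hp⟩
  have hp' := hp
  rw [hI] at hp'
  obtain ⟨p1, h1, p2, h2, rfl⟩ := Submodule.mem_sup.1 hp'
  obtain ⟨q, hq, rfl⟩ := Ideal.mem_span_singleton_mul.1 h2
  obtain ⟨f, hf⟩ := F.aug_surjective ⟨p1, h1⟩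
  obtain ⟨g, hg⟩ := G.aug_surjective ⟨q, hq⟩
  exact ⟨(f, g, 0), Subtype.ext (by rw [coneAug_apply, hf, hg])⟩

/-- This is $A\cap xB=xA$ on the level of relations: if $\mathrm{aug} f+x\,\mathrm{aug} g=0$, then
$-\mathrm{aug} g\in A$ lifts to some $w$, and $(f,g)$ differs from $(xw,-\varphi w)$ by boundaries.
-/
theorem coneAug_exact {F : MinimalGradedFreeResolution A} {G : MinimalGradedFreeResolution B}
    {φ : ∀ i, (F.idx i →₀ MvPolynomial (Fin n) k) →ₗ[MvPolynomial (Fin n) k]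
        (G.idx i →₀ MvPolynomial (Fin n) k)}
    (hφ : ∀ v, (G.aug (φ 0 v) : MvPolynomial (Fin n) k) = F.aug v)
    {x : MvPolynomial (Fin n) k} (hxA : ∀ p, x * p ∈ A → p ∈ A)
    (hI : I = A ⊔ Ideal.span {x} * B) :
    Function.Exact (coneD F G φ x 0) (coneAug F G x hI) := by
  rintro ⟨f, g, f'⟩
  rw [← Submodule.coe_eq_zero, coneAug_apply]
  constructor
  · intro h
    have hg : -(G.aug g : MvPolynomial (Fin n) k) ∈ A := by
      refine hxA _ ?_
      rw [mul_neg, ← eq_neg_of_add_eq_zero_left h]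
      exact (F.aug f).2
    obtain ⟨w, hw⟩ := F.aug_surjective ⟨_, hg⟩
    have hw' : (F.aug w : MvPolynomial (Fin n) k) = -G.aug g := by rw [hw]
    obtain ⟨u, hu⟩ : f - x • w ∈ LinearMap.range (F.d 0) := by
      rw [F.mem_range_d_zero, ← Submodule.coe_eq_zero, map_sub, map_smul, Submodule.coe_sub,
        Submodule.coe_smul, smul_eq_mul, hw', mul_neg, sub_neg_eq_add, h]
    obtain ⟨v, hv⟩ : g + φ 0 w ∈ LinearMap.range (G.d 0) := by
      rw [G.mem_range_d_zero, ← Submodule.coe_eq_zero, map_add, Submodule.coe_add, hφ, hw',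
        add_neg_cancel]
    refine ⟨(u, v, (unshift k n F.idx 0).symm w), ?_⟩
    have : Subsingleton (shiftedIdx F.idx 0 →₀ MvPolynomial (Fin n) k) :=
      inferInstanceAs (Subsingleton (Empty →₀ MvPolynomial (Fin n) k))
    rw [coneD_apply, LinearEquiv.apply_symm_apply, hu, hv, sub_add_cancel, add_sub_cancel_right,
      Subsingleton.elim (-F.shiftedD 0 w) f']
  · rintro ⟨⟨u, v, w⟩, h⟩
    rw [coneD_apply, Prod.mk.injEq, Prod.mk.injEq] at h
    obtain ⟨rfl, rfl, -⟩ := h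
    rw [map_add, map_sub, aug_d, aug_d, zero_add, zero_sub, map_smul, Submodule.coe_smul,
      Submodule.coe_neg, hφ, smul_eq_mul, mul_neg, add_neg_cancel]

end MinimalGradedFreeResolution

open MinimalGradedFreeResolution

theorem exact_conj {R M₁ M₂ M₃ N₁ N₂ N₃ : Type*} [Ring R] [AddCommGroup M₁] [AddCommGroup M₂]
    [AddCommGroup M₃] [AddCommGroup N₁] [AddCommGroup N₂] [AddCommGroup N₃] [Module R M₁]
    [Module R M₂] [Module R M₃] [Module R N₁] [Module R N₂] [Module R N₃] (e₁ : M₁ ≃ₗ[R] N₁)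
    (e₂ : M₂ ≃ₗ[R] N₂) (e₃ : M₃ ≃ₗ[R] N₃) {f : N₁ →ₗ[R] N₂} {g : N₂ →ₗ[R] N₃}
    (h : Function.Exact f g) :
    Function.Exact (e₂.symm.toLinearMap ∘ₗ f ∘ₗ e₁.toLinearMap)
      (e₃.symm.toLinearMap ∘ₗ g ∘ₗ e₂.toLinearMap) := by
  intro y
  simp only [LinearMap.comp_apply, LinearEquiv.coe_coe, EmbeddingLike.map_eq_zero_iff]
  rw [h (e₂ y)]
  constructor
  · rintro ⟨w, hw⟩
    exact ⟨e₁.symm w, by simp [hw]⟩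
  · rintro ⟨v, rfl⟩
    exact ⟨e₁ v, by simp⟩

theorem isHomogeneous_single_one {ι : Type*} (b c : ι) :
    (Finsupp.single b (1 : MvPolynomial (Fin n) k) c).IsHomogeneous 0 := by
  classical
  rw [Finsupp.single_apply]
  split_ifs
  · exact isHomogeneous_one _ _
  · exact isHomogeneous_zero _ _ _

/-- If `A` and `B ⊇ A` have linear resolutions in degrees `a + 1` and `a`, and the linear form `x`
is a nonzerodivisor modulo `A`, then `A + x B` has a linear resolution in degree `a + 1`. -/
theorem HasLinearBetti.cone {I A B : Ideal (MvPolynomial (Fin n) k)} {a : ℕ}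
    {P Q : PowerSeries ℕ} (hA : HasLinearBetti A (a + 1) P) (hB : HasLinearBetti B a Q)
    (hAB : A ≤ B) {x : MvPolynomial (Fin n) k} (hx : x.IsHomogeneous 1) (hx0 : x ≠ 0)
    (hxA : ∀ p, x * p ∈ A → p ∈ A) (hI : I = A ⊔ Ideal.span {x} * B) :
    HasLinearBetti I (a + 1) (P + Q + PowerSeries.X * P) := by
  obtain ⟨F, hF, hFP⟩ := hA
  obtain ⟨G, hG, hGQ⟩ := hB
  obtain ⟨φ, hφ, hφ0, hφd⟩ := F.exists_comparison G hAB
  have := F.finite_idx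
  have := G.finite_idx
  let E := fun i => sumProdEquiv k n (F.idx i) (G.idx i) (shiftedIdx F.idx i)
  refine .of_complex (fun i => F.idx i ⊕ G.idx i ⊕ shiftedIdx F.idx i)
    (fun i => (E i).symm.toLinearMap ∘ₗ coneD F G φ x i ∘ₗ (E (i + 1)).toLinearMap)
    (coneAug F G x hI ∘ₗ (E 0).toLinearMap) (fun i b c => ?_) (fun b => ?_) ?_ ?_ (fun i => ?_)
    (fun i => ?_)
  · have h0 : (0 : MvPolynomial (Fin n) k).IsHomogeneous 1 := isHomogeneous_zero _ _ _
    change (((E i).symm (coneD F G φ x i (E (i + 1) (Finsupp.single b 1)))) c).IsHomogeneous 1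
    rcases b with b | b | b
    · rw [sumProdEquiv_single_inl, coneD_apply]
      refine isHomogeneous_sumProdEquiv_symm ?_ ?_ ?_ c <;>
        simp [h0, F.isHomogeneous_d_of_linear hF]
    · rw [sumProdEquiv_single_inr_inl, coneD_apply]
      refine isHomogeneous_sumProdEquiv_symm ?_ ?_ ?_ c <;>
        simp [h0, G.isHomogeneous_d_of_linear hG]
    · rw [sumProdEquiv_single_inr_inr, coneD_apply]
      obtain ⟨b, hb⟩ := exists_unshift_single (k := k) (n := n) F.idx i b
      rw [hb]
      refine isHomogeneous_sumProdEquiv_symm (fun c => ?_) (fun c => ?_) (fun c => ?_) c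
      · rw [map_zero, zero_add, Finsupp.smul_apply, smul_eq_mul]
        exact hx.mul (isHomogeneous_single_one b c)
      · change ((G.d i 0 - φ i (Finsupp.single b 1)) c).IsHomogeneous 1
        rw [map_zero, zero_sub, Finsupp.neg_apply]
        refine (isHomogeneous_of_degree fun m hm => ?_).neg
        -- Here `F` starts one degree above `G`, so the degree-zero map `φ i` has linear entries.
        have := hφ i b c m hm
        rw [hF, hG] at this
        omega
      · change ((-F.shiftedD i (Finsupp.single b 1)) c).IsHomogeneous 1
        rw [Finsupp.neg_apply]
        exact (F.isHomogeneous_shiftedD_of_linear hF i b c).neg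
  · rcases b with b | b | b
    · simpa [E, coneAug_apply, hF] using F.aug_graded b
    · have := hx.mul (G.aug_graded b)
      rw [hG, zero_add, add_comm 1] at this
      simpa [E, coneAug_apply] using this
    · exact b.elim
  · exact (coneAug_surjective F G x hI).comp (E 0).surjective
  · exact exact_conj (E 1) (E 0) (LinearEquiv.refl _ _) (coneAug_exact hφ0 hxA hI)
  · exact exact_conj (E (i + 2)) (E (i + 1)) (E i) (coneD_exact hφd hx0 i)
  · rw [Nat.card_sum, Nat.card_sum, hFP, hGQ, map_add, map_add, add_assoc]
    congr 2
    cases i with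
    | zero =>
      rw [PowerSeries.coeff_zero_X_mul]
      exact Nat.card_of_isEmpty (α := Empty)
    | succ i => rw [PowerSeries.coeff_succ_X_mul, ← hFP]; rfl

end MappingCone

/-! ### Ideals not involving a variable -/

section FreeOfVariable

variable {k : Type*} [Field k] {n : ℕ}

/-- The ideal `A` is generated by polynomials that do not involve the variable `x_j`, in the form
that multiplication by them commutes with division by `x_j`. -/
def IsFreeOf (j : Fin n) (A : Ideal (MvPolynomial (Fin n) k)) : Prop :=
  ∃ S : Set (MvPolynomial (Fin n) k), A = Ideal.span S ∧
    ∀ s ∈ S, ∀ p, (s * p).divMonomial (Finsupp.single j 1) =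
      s * p.divMonomial (Finsupp.single j 1)

theorem isFreeOf_one (j : Fin n) : IsFreeOf j (1 : Ideal (MvPolynomial (Fin n) k)) :=
  ⟨{1}, by simp, by simp⟩

open scoped Pointwise in
theorem IsFreeOf.mul {j : Fin n} {A B : Ideal (MvPolynomial (Fin n) k)} (hA : IsFreeOf j A)
    (hB : IsFreeOf j B) : IsFreeOf j (A * B) := by
  obtain ⟨S, rfl, hS⟩ := hA
  obtain ⟨T, rfl, hT⟩ := hB
  refine ⟨S * T, Ideal.span_mul_span' S T, ?_⟩
  rintro _ ⟨s, hs, t, ht, rfl⟩ p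
  simp only [mul_assoc, hS s hs, hT t ht]

theorem IsFreeOf.pow {j : Fin n} {A : Ideal (MvPolynomial (Fin n) k)} (hA : IsFreeOf j A)
    (a : ℕ) : IsFreeOf j (A ^ a) := by
  induction a with
  | zero => exact isFreeOf_one j
  | succ a ih => exact ih.mul hA

theorem IsFreeOf.prod {ι : Type*} {j : Fin n} (T : Finset ι)
    {A : ι → Ideal (MvPolynomial (Fin n) k)} (hA : ∀ l ∈ T, IsFreeOf j (A l)) :
    IsFreeOf j (∏ l ∈ T, A l) :=
  Finset.prod_induction _ (IsFreeOf j) (fun _ _ => .mul) (isFreeOf_one j) hA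

theorem X_mul_divMonomial_of_ne {i j : Fin n} (h : i ≠ j) (p : MvPolynomial (Fin n) k) :
    (X i * p).divMonomial (Finsupp.single j 1) = X i * p.divMonomial (Finsupp.single j 1) := by
  classical
  ext m
  rw [coeff_divMonomial, coeff_X_mul', coeff_X_mul', coeff_divMonomial]
  have h1 : (i ∈ (Finsupp.single j 1 + m).support) ↔ i ∈ m.support := by
    simp [h.symm]
  by_cases hi : i ∈ m.support
  · rw [if_pos (h1.2 hi), if_pos hi]
    congr 1
    refine add_tsub_assoc_of_le ?_ _
    rw [Finsupp.single_le_iff]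
    exact Nat.one_le_iff_ne_zero.2 (Finsupp.mem_support_iff.1 hi)
  · rw [if_neg (mt h1.1 hi), if_neg hi]

theorem isFreeOf_monomialPrime {j : Fin n} {J : Finset (Fin n)} (hj : j ∉ J) :
    IsFreeOf j (monomialPrime k J) := by
  refine ⟨_, rfl, ?_⟩
  rintro _ ⟨i, hi, rfl⟩ p
  exact X_mul_divMonomial_of_ne (ne_of_mem_of_not_mem (Finset.mem_coe.1 hi) hj) p

/-- Division by $x_j$, which discards the terms not divisible by $x_j$, is additive and passes
through the generators. As it undoes multiplication by $x_j$, stability under it makes $x_j$ a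
nonzerodivisor modulo `A`. -/
theorem IsFreeOf.divMonomial_mem {j : Fin n} {A : Ideal (MvPolynomial (Fin n) k)}
    (hA : IsFreeOf j A) {p : MvPolynomial (Fin n) k} (hp : p ∈ A) :
    p.divMonomial (Finsupp.single j 1) ∈ A := by
  obtain ⟨S, rfl, hS⟩ := hA
  induction hp using Submodule.closure_induction with
  | zero => simp
  | add p q _ _ hp hq =>
    rw [add_divMonomial]
    exact add_mem hp hq
  | smul_mem r s hs =>
    rw [smul_eq_mul, mul_comm, hS s hs]
    exact Ideal.mul_mem_right _ _ (Ideal.subset_span hs)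

theorem IsFreeOf.mem_of_X_mul_mem {j : Fin n} {A : Ideal (MvPolynomial (Fin n) k)}
    (hA : IsFreeOf j A) {p : MvPolynomial (Fin n) k} (hp : X j * p ∈ A) : p ∈ A := by
  simpa using hA.divMonomial_mem hp

end FreeOfVariable

/-! ### Powers of monomial primes and intersections -/

section MonomialPrime

variable {k : Type*} [Field k] {n : ℕ}

theorem monomialPrime_empty : monomialPrime k (∅ : Finset (Fin n)) = ⊥ := by
  simp [monomialPrime]

theorem monomialPrime_insert (x : Fin n) (J : Finset (Fin n)) :
    monomialPrime k (insert x J) = monomialPrime k J ⊔ Ideal.span {X x} := by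
  rw [monomialPrime, Finset.coe_insert, Set.image_insert_eq, Ideal.span_insert, sup_comm,
    monomialPrime]

theorem sup_pow_succ {R : Type*} [CommSemiring R] (A B : Ideal R) (a : ℕ) :
    (A ⊔ B) ^ (a + 1) = A ^ (a + 1) ⊔ B * (A ⊔ B) ^ a := by
  induction a with
  | zero => simp
  | succ a ih =>
    -- All mixed terms are absorbed by the summand with a factor `B`.
    have h : A * (B * (A ⊔ B) ^ a) ≤ B * (A ⊔ B) ^ (a + 1) := by
      rw [mul_left_comm, pow_succ']
      exact Ideal.mul_mono_right (Ideal.mul_mono_left le_sup_left)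
    rw [pow_succ' _ (a + 1), Ideal.sup_mul]
    nth_rw 1 [ih]
    rw [Ideal.mul_sup, ← pow_succ', sup_assoc, sup_eq_right.2 h]

theorem monomialPrime_insert_pow_succ (x : Fin n) (J : Finset (Fin n)) (a : ℕ) :
    monomialPrime k (insert x J) ^ (a + 1) =
      monomialPrime k J ^ (a + 1) ⊔ Ideal.span {X x} * monomialPrime k (insert x J) ^ a := by
  rw [monomialPrime_insert, sup_pow_succ]

theorem monomialPrime_mono {J J' : Finset (Fin n)} (h : J ⊆ J') :
    monomialPrime k J ≤ monomialPrime k J' :=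
  Ideal.span_mono (Set.image_mono (Finset.coe_subset.2 h))

/-- Double induction on `J` and `a`. Write $f=g+xh$ with $g\in\mathfrak m_{J'}^{a+1}$,
$h\in\mathfrak m_J^a$, and let $D$ be division by $x$. Then $f=(g-xDg)+x(Dg+h)$. Since $Df=Dg+h\in
Q$, both brackets lie in $Q$; the first falls under induction on `J`, the second under induction on
`a`. -/
theorem monomialPrime_pow_inf (J : Finset (Fin n)) {Q : Ideal (MvPolynomial (Fin n) k)}
    (hQ : ∀ j ∈ J, IsFreeOf j Q) (a : ℕ) :
    monomialPrime k J ^ a ⊓ Q = monomialPrime k J ^ a * Q := by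
  refine le_antisymm ?_ Ideal.mul_le_inf
  induction J using Finset.induction_on generalizing a with
  | empty =>
    cases a with
    | zero => simp
    | succ a => simp [monomialPrime_empty]
  | insert x J hx ihJ =>
    induction a with
    | zero => simp
    | succ a iha =>
      rintro f ⟨hf, hfQ⟩
      have hxQ := hQ x (Finset.mem_insert_self x J)
      have hxJ := (isFreeOf_monomialPrime (k := k) hx).pow (a + 1)
      rw [SetLike.mem_coe, monomialPrime_insert_pow_succ] at hf
      obtain ⟨g, hg, f', hf', rfl⟩ := Submodule.mem_sup.1 hf
      obtain ⟨h, hh, rfl⟩ := Ideal.mem_span_singleton_mul.1 hf'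
      set D : MvPolynomial (Fin n) k → MvPolynomial (Fin n) k :=
        fun p => p.divMonomial (Finsupp.single x 1)
      have hle : monomialPrime k J ^ (a + 1) ≤ monomialPrime k (insert x J) ^ (a + 1) :=
        Ideal.pow_right_mono (monomialPrime_mono (Finset.subset_insert x J)) _
      have hD : D g + h ∈ Q := by
        have := hxQ.divMonomial_mem hfQ
        rwa [add_divMonomial, X_mul_divMonomial] at this
      have hDg : D g ∈ monomialPrime k J ^ (a + 1) := hxJ.divMonomial_mem hg
      have h1 : g - X x * D g ∈ monomialPrime k J ^ (a + 1) * Q := by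
        refine ihJ (fun j hj => hQ j (Finset.mem_insert_of_mem hj)) (a + 1) ⟨?_, ?_⟩
        · exact sub_mem hg (Ideal.mul_mem_left _ _ hDg)
        · have := sub_mem hfQ (Ideal.mul_mem_left _ (X x) hD)
          rwa [mul_add, add_sub_add_right_eq_sub] at this
      have h2 : D g + h ∈ monomialPrime k (insert x J) ^ a * Q :=
        iha ⟨add_mem (Ideal.pow_le_pow_right (Nat.le_succ a) (hle hDg)) hh, hD⟩
      rw [monomialPrime_insert_pow_succ, Ideal.sup_mul, mul_assoc]
      have h3 : g + X x * h = (g - X x * D g) + X x * (D g + h) := by ring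
      rw [h3]
      exact add_mem (Ideal.mem_sup_left h1) (Ideal.mem_sup_right
        (Ideal.mul_mem_mul (Ideal.mem_span_singleton_self _) h2))

end MonomialPrime

/-! ### The generating function of the Betti numbers -/

section BettiSeries

/-- The generating function of the Betti numbers of the `a`-th power of the ideal generated by `r`
variables. -/
def bettiSeries (r a : ℕ) : PowerSeries ℕ :=
  PowerSeries.mk fun i => (a + r - 1).choose (a + i) * (a + i - 1).choose i

/-- At $i=0$ both binomials have lower index 0, so truncated subtraction is harmless; for $i>0$ the
factor $\binom{i-1}{i}$ vanishes. -/
theorem bettiSeries_zero_right (r : ℕ) : bettiSeries r 0 = 1 := by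
  ext i
  rw [bettiSeries, PowerSeries.coeff_mk, PowerSeries.coeff_one]
  cases i with
  | zero => simp
  | succ i => simp

theorem bettiSeries_zero_succ (a : ℕ) : bettiSeries 0 (a + 1) = 0 := by
  ext i
  rw [bettiSeries, PowerSeries.coeff_mk, Nat.choose_eq_zero_of_lt (by omega)]
  simp

/-- The numerical counterpart of the cone, obtained by applying Pascal's rule to both binomials. -/
theorem bettiSeries_succ_succ (r a : ℕ) :
    bettiSeries (r + 1) (a + 1) = bettiSeries r (a + 1) + bettiSeries (r + 1) a +
      PowerSeries.X * bettiSeries r (a + 1) := by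
  ext i
  rw [map_add, map_add]
  cases i with
  | zero =>
    rw [PowerSeries.coeff_zero_X_mul]
    simp only [bettiSeries, PowerSeries.coeff_mk, add_zero, Nat.choose_zero_right, mul_one]
    rw [show a + 1 + (r + 1) - 1 = (a + r) + 1 by omega, show a + 1 + r - 1 = a + r by omega,
      show a + (r + 1) - 1 = a + r by omega, Nat.choose_succ_succ, add_comm]
  | succ i =>
    rw [PowerSeries.coeff_succ_X_mul]
    simp only [bettiSeries, PowerSeries.coeff_mk]
    rw [show a + 1 + (r + 1) - 1 = (a + r) + 1 by omega, show a + 1 + r - 1 = a + r by omega,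
      show a + (r + 1) - 1 = a + r by omega, show a + 1 + (i + 1) - 1 = (a + i) + 1 by omega,
      show a + (i + 1) - 1 = a + i by omega, show a + 1 + i - 1 = a + i by omega,
      show a + 1 + (i + 1) = (a + i + 1) + 1 by omega, show a + (i + 1) = a + i + 1 by omega,
      show a + 1 + i = a + i + 1 by omega, Nat.choose_succ_succ (a + r), Nat.choose_succ_succ (a + i)]
    ring

theorem coeff_prod_bettiSeries (s : ℕ) (r a : Fin s → ℕ) (i : ℕ) :
    PowerSeries.coeff i (∏ l, bettiSeries (r l) (a l)) =
      ∑ t ∈ Finset.Nat.antidiagonalTuple s i, ∏ l,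
        (a l + r l - 1).choose (a l + t l) * (a l + t l - 1).choose (t l) := by
  rw [PowerSeries.coeff_prod]
  refine Finset.sum_equiv Finsupp.equivFunOnFinite (fun t => ?_) fun t _ => ?_
  · simp [Finset.mem_finsuppAntidiag, Finset.Nat.mem_antidiagonalTuple]
  · simp [bettiSeries]

end BettiSeries

/-! ### Products of powers of monomial primes -/

section ProductsOfPowers

variable {k : Type*} [Field k] {n : ℕ}

theorem HasLinearBetti.monomialPrime_pow_mul {Q : Ideal (MvPolynomial (Fin n) k)} {q : ℕ}
    {C : PowerSeries ℕ} (hQ : HasLinearBetti Q q C) (J : Finset (Fin n))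
    (hJ : ∀ j ∈ J, IsFreeOf j Q) (a : ℕ) :
    HasLinearBetti (monomialPrime k J ^ a * Q) (a + q) (bettiSeries J.card a * C) := by
  induction J using Finset.induction_on generalizing a with
  | empty =>
    cases a with
    | zero => simpa [bettiSeries_zero_right] using hQ
    | succ a => simpa [monomialPrime_empty, bettiSeries_zero_succ] using hasLinearBetti_bot _
  | insert x J hx ihJ =>
    induction a with
    | zero => simpa [bettiSeries_zero_right] using hQ
    | succ a iha =>
      have hA := ihJ (fun j hj => hJ j (Finset.mem_insert_of_mem hj)) (a + 1)
      rw [add_right_comm] at hA ⊢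
      have hfree : IsFreeOf x (monomialPrime k J ^ (a + 1) * Q) :=
        ((isFreeOf_monomialPrime hx).pow _).mul (hJ x (Finset.mem_insert_self x J))
      -- The cone joins the two induction hypotheses: fewer variables with exponent `a + 1`, and the
      -- same variables with exponent `a`.
      have := hA.cone (I := monomialPrime k (insert x J) ^ (a + 1) * Q) iha
        (Ideal.mul_mono_left ((Ideal.pow_right_mono (monomialPrime_mono
          (Finset.subset_insert x J)) _).trans (Ideal.pow_le_pow_right (Nat.le_succ a))))
        (isHomogeneous_X k x) (X_ne_zero x) (fun p => hfree.mem_of_X_mul_mem)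
        (by rw [monomialPrime_insert_pow_succ, Ideal.sup_mul, mul_assoc])
      rw [Finset.card_insert_of_notMem hx] at this ⊢
      rw [bettiSeries_succ_succ]
      convert this using 1
      ring

variable {ι : Type*} {J : ι → Finset (Fin n)}

theorem isFreeOf_prod_of_disjoint (hdisj : ∀ l l', l ≠ l' → Disjoint (J l) (J l')) (a : ι → ℕ)
    {l : ι} {T : Finset ι} (hl : l ∉ T) {j : Fin n} (hj : j ∈ J l) :
    IsFreeOf j (∏ l ∈ T, monomialPrime k (J l) ^ a l) :=
  .prod _ fun l' hl' => (isFreeOf_monomialPrime fun hj' =>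
    Finset.disjoint_left.1 (hdisj l l' fun h => hl (h ▸ hl')) hj hj').pow _

theorem hasLinearBetti_prod (hdisj : ∀ l l', l ≠ l' → Disjoint (J l) (J l')) (a : ι → ℕ)
    (T : Finset ι) : HasLinearBetti (∏ l ∈ T, monomialPrime k (J l) ^ a l) (∑ l ∈ T, a l)
      (∏ l ∈ T, bettiSeries (J l).card (a l)) := by
  classical
  induction T using Finset.induction_on with
  | empty => simpa using hasLinearBetti_top
  | insert l T hl ih =>
    rw [Finset.prod_insert hl, Finset.prod_insert hl, Finset.sum_insert hl]
    exact ih.monomialPrime_pow_mul (J l)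
      (fun j hj => isFreeOf_prod_of_disjoint hdisj a hl hj) (a l)

theorem prod_monomialPrime_pow_eq_iInf (hdisj : ∀ l l', l ≠ l' → Disjoint (J l) (J l'))
    (a : ι → ℕ) (T : Finset ι) :
    ∏ l ∈ T, monomialPrime k (J l) ^ a l = ⨅ l ∈ T, monomialPrime k (J l) ^ a l := by
  classical
  induction T using Finset.induction_on with
  | empty => simp
  | insert l T hl ih =>
    rw [Finset.prod_insert hl, Finset.iInf_insert, ← ih, monomialPrime_pow_inf]
    exact fun j hj => isFreeOf_prod_of_disjoint hdisj a hl hj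

end ProductsOfPowers

/-! ### Betti numbers of an arbitrary minimal resolution -/

section LinearBettiNumbers

variable {k : Type*} [Field k] {n : ℕ} {I : Ideal (MvPolynomial (Fin n) k)} {a : ℕ}
  {B : PowerSeries ℕ}

theorem HasLinearBetti.betti_eq_coeff (h : HasLinearBetti I a B)
    (F : MinimalGradedFreeResolution I) (i : ℕ) : F.betti i (i + a) = PowerSeries.coeff i B := by
  obtain ⟨G, hG, hB⟩ := h
  rw [F.betti_eq G, ← hB, MinimalGradedFreeResolution.betti]
  exact Nat.card_congr (Equiv.subtypeUnivEquiv (hG i))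

theorem HasLinearBetti.betti_eq_zero (h : HasLinearBetti I a B)
    (F : MinimalGradedFreeResolution I) {i j : ℕ} (hij : j ≠ i + a) : F.betti i j = 0 := by
  obtain ⟨G, hG, -⟩ := h
  rw [F.betti_eq G, MinimalGradedFreeResolution.betti]
  have : IsEmpty {b : G.idx i // G.deg i b = j} := ⟨fun b => hij (b.2.symm.trans (hG i b.1))⟩
  exact Nat.card_of_isEmpty

theorem HasLinearBetti.exists_span_eq (h : HasLinearBetti I a B) :
    ∃ S : Set (MvPolynomial (Fin n) k), (∀ f ∈ S, f.IsHomogeneous a) ∧ Ideal.span S = I := by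
  obtain ⟨F, hF, -⟩ := h
  refine ⟨Set.range fun b => (F.aug (Finsupp.single b 1) : MvPolynomial (Fin n) k), ?_,
    le_antisymm (Ideal.span_le.2 ?_) fun f hf => ?_⟩
  · rintro _ ⟨b, rfl⟩
    simpa [hF] using F.aug_graded b
  · rintro _ ⟨b, rfl⟩
    exact (F.aug _).2
  · obtain ⟨v, hv⟩ := F.aug_surjective ⟨f, hf⟩
    have hfv : f = F.aug v := by rw [hv]
    rw [hfv]
    clear hv hfv
    induction v using Finsupp.induction_linear with
    | zero => simp
    | add v w hv hw =>
      rw [map_add]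
      exact add_mem hv hw
    | single b p =>
      rw [← Finsupp.smul_single_one, map_smul]
      exact Ideal.mul_mem_left _ p (Ideal.subset_span ⟨b, rfl⟩)

theorem HasLinearBetti.nonempty (h : HasLinearBetti I a B) :
    Nonempty (MinimalGradedFreeResolution I) :=
  h.elim fun F _ => ⟨F⟩

theorem HasLinearBetti.hasLinearResolution (h : HasLinearBetti I a B) :
    HasLinearResolution I a :=
  ⟨h.exists_span_eq, h.nonempty, fun F _ _ => h.betti_eq_zero F⟩

end LinearBettiNumbers

theorem theorem2p9 {k : Type*} [Field k] (n s : ℕ) (J : Fin s → Finset (Fin n))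
    (hJ : ∀ l, (J l).Nonempty) (hdisj : ∀ l l', l ≠ l' → Disjoint (J l) (J l'))
    (a : Fin s → ℕ) (ha : ∀ l, 0 < a l) (I : Ideal (MvPolynomial (Fin n) k))
    (hI : I = ∏ l, monomialPrime k (J l) ^ a l) :
    (I = ⨅ l, monomialPrime k (J l) ^ a l) ∧
    HasLinearResolution I (∑ l, a l) ∧
    Nonempty (MinimalGradedFreeResolution I) ∧
    ∀ F : MinimalGradedFreeResolution I,
      (∀ i : ℕ, F.betti i (i + ∑ l, a l) =
        ∑ t ∈ Finset.Nat.antidiagonalTuple s i, ∏ l,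
          (a l + (J l).card - 1).choose (a l + t l) * (a l + t l - 1).choose (t l)) ∧
      (∀ i j : ℕ, j ≠ i + ∑ l, a l → F.betti i j = 0) := by
  subst hI
  have h := hasLinearBetti_prod (k := k) hdisj a Finset.univ
  refine ⟨?_, h.hasLinearResolution, h.nonempty, fun F =>
    ⟨fun i => ?_, fun _ _ => h.betti_eq_zero F⟩⟩
  · simpa using prod_monomialPrime_pow_eq_iInf (k := k) hdisj a Finset.univ
  · rw [h.betti_eq_coeff, coeff_prod_bettiSeries]
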